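/- Let $M$ be a smooth manifold of odd dimension $n$, let $F\in\Omega^2(M)$ be closed and $H\in\Omega^3(M)$ with $dH=-F\wedge F$. Let $E_{H,F}=TM\oplus T^*M\oplus\mathbb R$ be the Courant algebroid with scalar product $\langle X+\xi+a,Y+\eta+b\rangle=\frac12(\eta(X)+\xi(Y))+ab$, anchor $\pi:E_{H,F}\to TM$ the projection, and Dorfman bracket $$[X+\xi+a,Y+\eta+b]=\mathcal L_XY+\mathcal L_X\eta-i_Yd\xi+2b\,da+i_Xi_YH-2(b\,i_XF-a\,i_YF)+X(b)-Y(a)+F(X,Y).$$ A generalized metric $\mathcal G$ is a rank $n$ subbundle $E_-\subset E$ on which $\langle\cdot,\cdot\rangle$ is non-degenerate and which $\pi$ maps isomorphically onto $TM$; put $E_+=E_-^\perp$ and $\mathcal G^{\mathrm{end}}|_{E_\pm}=\pm\mathrm{Id}$. A $B_n$-generalized almost complex structure is a complex isotropic rank $n$ subbundle $L\subset E_{\mathbb C}$ with $L\cap\bar L=0$, or equivalently the endomorphism field $\mathcal F$ of $E$ that is $i$ on $L$, $-i$ on $\bar L$ and $0$ on $(L\oplus\bar L)^\perp$; it is a $B_n$-generalized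 complex structure if the sections of $L$ are closed under the Dorfman bracket. A $B_n$-generalized pseudo-Kähler structure is a pair $(\mathcal G,\mathcal F)$ of a generalized metric and a $B_n$-generalized almost complex structure with $\mathcal G^{\mathrm{end}}\mathcal F=\mathcal F\mathcal G^{\mathrm{end}}$ such that $\mathcal F$ and $\mathcal G^{\mathrm{end}}\mathcal F$ are both $B_n$-generalized complex structures. If $\mathcal G$ is in the standard form $E_-=\{X-i_Xg\mid X\in TM\}$, with $g$ a pseudo-Riemannian metric on $M$ (so that $E_+=\{X+i_Xg+a\}$), the components of $(\mathcal G,\mathcal F)$ are the tensor fields $(g,J_+,J_-,X_+,X_-)$ with $J_\pm\in\Gamma(\mathrm{End}\,TM)$, $X_\pm\in\mathfrak X(M)$, such that $$\mathcal F(X-i_Xg)=J_-X-i_{J_-X}g,\qquad \mathcal F(X+i_Xg+a)=Y+i_Yg-g(X_+,X)\ \text{ with } Y=J_+X+aX_+,$$ and $X_-=\pi(u_-)$ for a smooth section $u_-$ of $\mathrm{Ker}\,\mathcal F\cap E_-$ with $\langle u_-,u_-\rangle=-1$. **Statement.** Let $(\mathcal G,\mathcal F)$ be a $B_n$-generalized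 pseudo-Kähler structure on $E_{H,F}$ with components $(g,J_+,J_-,X_+,X_-)$, and let $\lambda\in\mathbb R\setminus\{0\}$. Then $\lambda F$ is closed, $d(\lambda^2H)=-(\lambda F)\wedge(\lambda F)$, and the data $(\lambda^2g,\,J_+,\,J_-,\,\frac1\lambda X_+,\,\frac1\lambda X_-)$ define a $B_n$-generalized pseudo-Kähler structure on $E_{\lambda^2H,\lambda F}$: there is exactly one $B_n$-generalized pseudo-Kähler structure on $E_{\lambda^2H,\lambda F}$ with these components. -/

import Mathlib

open scoped Manifold ContDiff TensorProduct

noncomputable section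

namespace BnGeom

/-! ### Differential forms on a manifold -/

section Forms

variable {n : ℕ} {M : Type*} [TopologicalSpace M] [ChartedSpace (EuclideanSpace ℝ (Fin n)) M]

/-- A (not necessarily smooth) field of alternating `k`-forms on the `n`-manifold `M`. -/
abbrev FormField (n : ℕ) (M : Type*) [TopologicalSpace M]
    [ChartedSpace (EuclideanSpace ℝ (Fin n)) M] (k : ℕ) : Type _ :=
  ∀ x : M, (TangentSpace (𝓡 n) x) [⋀^Fin k]→L[ℝ] ℝ

/-- The representative `(φ⁻¹)^* α` of a `k`-form in the preferred chart `φ` around `x₀`. -/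
def FormField.inChart {k : ℕ} (α : FormField n M k) (x₀ : M) (y : EuclideanSpace ℝ (Fin n)) :
    (EuclideanSpace ℝ (Fin n)) [⋀^Fin k]→L[ℝ] ℝ :=
  (α ((extChartAt (𝓡 n) x₀).symm y)).compContinuousLinearMap
    (mfderiv 𝓘(ℝ, EuclideanSpace ℝ (Fin n)) (𝓡 n) (extChartAt (𝓡 n) x₀).symm y)

/-- A `k`-form is smooth if its representatives in the charts are smooth. -/
def FormField.IsSmooth {k : ℕ} (α : FormField n M k) : Prop :=
  ∀ x₀ : M, ContDiffOn ℝ ∞ (α.inChart x₀) (extChartAt (𝓡 n) x₀).target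

/-- The exterior derivative, `(dα)_x = (φ^* d((φ⁻¹)^* α))_x` with `φ` the chart around `x`;
here `d` has the usual normalization `dξ(X, Y) = X(ξ(Y)) - Y(ξ(X)) - ξ([X, Y])`. -/
def FormField.d {k : ℕ} (α : FormField n M k) : FormField n M (k + 1) := fun x =>
  (extDeriv (α.inChart x) (extChartAt (𝓡 n) x x)).compContinuousLinearMap
    (mfderiv (𝓡 n) 𝓘(ℝ, EuclideanSpace ℝ (Fin n)) (extChartAt (𝓡 n) x) x)

/-- The pair `(H, F)` consists of a smooth `3`-form `H` and a smooth closed `2`-form `F` with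
`dH = -F ∧ F`, where
`(F ∧ F)(a, b, c, d) = 2 (F(a, b) F(c, d) - F(a, c) F(b, d) + F(a, d) F(b, c))`. -/
structure IsTwist (H : FormField n M 3) (F : FormField n M 2) : Prop where
  smooth_H : H.IsSmooth
  smooth_F : F.IsSmooth
  closed_F : F.d = 0
  d_H : ∀ (x : M) (a b c d : TangentSpace (𝓡 n) x),
    H.d x ![a, b, c, d] =
      -(2 * (F x ![a, b] * F x ![c, d] - F x ![a, c] * F x ![b, d] + F x ![a, d] * F x ![b, c]))

end Forms

/-! ### The Courant algebroid `E_{H,F}` -/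

section Courant

variable {n : ℕ} {M : Type*} [TopologicalSpace M] [ChartedSpace (EuclideanSpace ℝ (Fin n)) M]

/-- The fibre at `x` of `E = TM ⊕ T^*M ⊕ ℝ`. -/
abbrev Fiber (n : ℕ) {M : Type*} [TopologicalSpace M]
    [ChartedSpace (EuclideanSpace ℝ (Fin n)) M] (x : M) : Type :=
  TangentSpace (𝓡 n) x × (TangentSpace (𝓡 n) x →L[ℝ] ℝ) × ℝ

instance (x : M) : FiniteDimensional ℝ (TangentSpace (𝓡 n) x) :=
  inferInstanceAs (FiniteDimensional ℝ (EuclideanSpace ℝ (Fin n)))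

instance (x : M) : FiniteDimensional ℝ (TangentSpace (𝓡 n) x →L[ℝ] ℝ) :=
  inferInstanceAs (FiniteDimensional ℝ (EuclideanSpace ℝ (Fin n) →L[ℝ] ℝ))

/-- The scalar product `⟨X + ξ + a, Y + η + b⟩ = (η(X) + ξ(Y)) / 2 + a b`. -/
def pairing (x : M) : LinearMap.BilinForm ℝ (Fiber n x) :=
  LinearMap.mk₂ ℝ (fun u v => (v.2.1 u.1 + u.2.1 v.1) / 2 + u.2.2 * v.2.2)
    (by intros; simp; ring) (by intros; simp; ring) (by intros; simp; ring) (by intros; simp; ring)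

theorem pairing_isRefl (x : M) : (pairing (n := n) x).IsRefl := by
  intro u v h
  simp only [pairing, LinearMap.mk₂_apply] at h ⊢
  linarith

/-- The anchor `π : E → TM`. -/
def anchor (x : M) : Fiber n x →ₗ[ℝ] TangentSpace (𝓡 n) x :=
  LinearMap.fst ℝ _ _

variable [IsManifold (𝓡 n) ∞ M] in
/-- `u` is a smooth section of `E` over `s`: its vector field, its one-form and its function
are smooth on `s`. -/
structure IsSmoothSectionOn (u : ∀ x : M, Fiber n x) (s : Set M) : Prop where
  vector : ContMDiffOn (𝓡 n) (𝓡 n).tangent ∞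
    (fun x => (⟨x, (u x).1⟩ : TangentBundle (𝓡 n) M)) s
  form : ContMDiffOn (𝓡 n) ((𝓡 n).prod 𝓘(ℝ, EuclideanSpace ℝ (Fin n) →L[ℝ] ℝ)) ∞
    (fun x => Bundle.TotalSpace.mk' (EuclideanSpace ℝ (Fin n) →L[ℝ] ℝ)
      (E := fun x : M => TangentSpace (𝓡 n) x →L[ℝ] Bundle.Trivial M ℝ x) x (u x).2.1) s
  function : ContMDiffOn (𝓡 n) 𝓘(ℝ, ℝ) ∞ (fun x => (u x).2.2) s

/-- The differential of a function. -/
def dFun (f : M → ℝ) (x : M) : TangentSpace (𝓡 n) x →L[ℝ] ℝ :=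
  mfderiv (𝓡 n) 𝓘(ℝ, ℝ) f x

/-- `i_Y dξ` for a one-form `ξ` and a vector field `Y`. -/
def contractD (Y : ∀ x : M, TangentSpace (𝓡 n) x) (ξ : ∀ x : M, TangentSpace (𝓡 n) x →L[ℝ] ℝ)
    (x : M) : TangentSpace (𝓡 n) x →L[ℝ] ℝ :=
  (FormField.d (fun z => ContinuousAlternatingMap.ofSubsingleton ℝ _ ℝ (0 : Fin 1) (ξ z))
    x).toContinuousLinearMap ![Y x, 0] 1

/-- The Lie derivative of a one-form, `ℒ_X η = i_X dη + d(η(X))`. -/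
def lieForm (X : ∀ x : M, TangentSpace (𝓡 n) x) (η : ∀ x : M, TangentSpace (𝓡 n) x →L[ℝ] ℝ)
    (x : M) : TangentSpace (𝓡 n) x →L[ℝ] ℝ :=
  contractD X η x + dFun (fun z => η z (X z)) x

/-- The Dorfman bracket twisted by `(H, F)`:
`[X + ξ + a, Y + η + b] = ℒ_X Y + ℒ_X η - i_Y dξ + 2 b da + i_X i_Y H - 2 (b i_X F - a i_Y F)
  + X(b) - Y(a) + F(X, Y)`, where `i_X i_Y H = H(Y, X, ·)`. -/
def dorfman (H : FormField n M 3) (F : FormField n M 2) (u v : ∀ x : M, Fiber n x) (x : M) :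
    Fiber n x :=
  let X := fun z => (u z).1
  let ξ := fun z => (u z).2.1
  let a := fun z => (u z).2.2
  let Y := fun z => (v z).1
  let η := fun z => (v z).2.1
  let b := fun z => (v z).2.2
  (VectorField.mlieBracket (𝓡 n) X Y x,
    lieForm X η x - contractD Y ξ x + (2 * b x) • dFun a x
      + (H x).toContinuousLinearMap ![Y x, X x, 0] 2
      - (2 : ℝ) • (b x • (F x).toContinuousLinearMap ![X x, 0] 1
          - a x • (F x).toContinuousLinearMap ![Y x, 0] 1),
    dFun b x (X x) - dFun a x (Y x) + F x ![X x, Y x])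

end Courant

/-! ### Generalized metrics -/

section Metric

variable {n : ℕ} {M : Type*} [TopologicalSpace M] [ChartedSpace (EuclideanSpace ℝ (Fin n)) M]
  [IsManifold (𝓡 n) ∞ M]

/-- An (admissible) generalized metric: a smooth rank `n` subbundle `E₋ ⊂ E` on which the scalar
product is non-degenerate and which the anchor maps isomorphically onto `TM`. -/
structure GeneralizedMetric (n : ℕ) (M : Type*) [TopologicalSpace M]
    [ChartedSpace (EuclideanSpace ℝ (Fin n)) M] [IsManifold (𝓡 n) ∞ M] where
  minus : ∀ x : M, Submodule ℝ (Fiber n x)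
  smooth : ∀ x₀ : M, ∃ U : Set M, IsOpen U ∧ x₀ ∈ U ∧ ∃ s : Fin n → ∀ x : M, Fiber n x,
    (∀ i, IsSmoothSectionOn (s i) U) ∧
    ∀ x ∈ U, LinearIndependent ℝ (fun i => s i x) ∧
      Submodule.span ℝ (Set.range fun i => s i x) = minus x
  nondegenerate : ∀ x, ((pairing x).restrict (minus x)).Nondegenerate
  admissible : ∀ x, Function.Bijective ((anchor x).domRestrict (minus x))

/-- `E₊ = E₋^⊥`. -/
def GeneralizedMetric.plus (G : GeneralizedMetric n M) (x : M) : Submodule ℝ (Fiber n x) :=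
  (pairing x).orthogonal (G.minus x)

theorem GeneralizedMetric.isCompl (G : GeneralizedMetric n M) (x : M) :
    IsCompl (G.plus x) (G.minus x) :=
  (LinearMap.BilinForm.isCompl_orthogonal_of_restrict_nondegenerate (pairing_isRefl x)
    (G.nondegenerate x)).symm

/-- The endomorphism `𝒢^end` of `E` with `𝒢^end = ± Id` on `E_±`: the difference of the
projections onto `E₊` and `E₋`. -/
def GeneralizedMetric.gEnd (G : GeneralizedMetric n M) (x : M) : Module.End ℝ (Fiber n x) :=
  Submodule.projection (G.plus x) (G.minus x) (G.isCompl x) -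
    Submodule.projection (G.minus x) (G.plus x) (G.isCompl x).symm

end Metric

/-! ### `B_n`-generalized complex structures -/

section Complex

variable {n : ℕ} {M : Type*} [TopologicalSpace M] [ChartedSpace (EuclideanSpace ℝ (Fin n)) M]
  [IsManifold (𝓡 n) ∞ M]

/-- The fibre at `x` of the complexification `E_ℂ`. -/
abbrev FiberC (n : ℕ) {M : Type*} [TopologicalSpace M]
    [ChartedSpace (EuclideanSpace ℝ (Fin n)) M] (x : M) : Type :=
  ℂ ⊗[ℝ] Fiber n x

/-- The element `u + i v` of `E_ℂ`. -/
def mkC {x : M} (u v : Fiber n x) : FiberC n x :=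
  (1 : ℂ) ⊗ₜ[ℝ] u + Complex.I ⊗ₜ[ℝ] v

/-- The complex bilinear extension of the scalar product. -/
def pairingC (x : M) : LinearMap.BilinForm ℂ (FiberC n x) :=
  LinearMap.BilinForm.baseChange ℂ (pairing x)

/-- Complex conjugation on `E_ℂ`. -/
def conjC (x : M) : FiberC n x →ₗ[ℝ] FiberC n x :=
  TensorProduct.map Complex.conjAe.toLinearMap LinearMap.id

/-- A field of complex subspaces of rank `r` of `E_ℂ` is a smooth complex subbundle of rank `r`
if it has local frames by smooth sections `s i + √-1 t i`. -/
def IsSmoothSubbundleC (r : ℕ) (L : ∀ x : M, Submodule ℂ (FiberC n x)) : Prop :=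
  ∀ x₀ : M, ∃ U : Set M, IsOpen U ∧ x₀ ∈ U ∧ ∃ s t : Fin r → ∀ x : M, Fiber n x,
    (∀ i, IsSmoothSectionOn (s i) U ∧ IsSmoothSectionOn (t i) U) ∧
    ∀ x ∈ U, LinearIndependent ℂ (fun i => mkC (s i x) (t i x)) ∧
      Submodule.span ℂ (Set.range fun i => mkC (s i x) (t i x)) = L x

/-- A complex isotropic smooth rank `n` subbundle `L ⊂ E_ℂ` with `L ∩ conj L = 0`. -/
structure IsAlmostComplexBundle (L : ∀ x : M, Submodule ℂ (FiberC n x)) : Prop where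
  subbundle : IsSmoothSubbundleC n L
  isotropic : ∀ x, ∀ w ∈ L x, ∀ z ∈ L x, pairingC x w z = 0
  transversal : ∀ x, ∀ w ∈ L x, conjC x w ∈ L x → w = 0

/-- `L` is integrable: its smooth sections are closed under the (complex bilinear extension of
the) Dorfman bracket twisted by `(H, F)`. -/
def IsIntegrable (H : FormField n M 3) (F : FormField n M 2)
    (L : ∀ x : M, Submodule ℂ (FiberC n x)) : Prop :=
  ∀ u₁ v₁ u₂ v₂ : ∀ x : M, Fiber n x,
    IsSmoothSectionOn u₁ Set.univ → IsSmoothSectionOn v₁ Set.univ →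
    IsSmoothSectionOn u₂ Set.univ → IsSmoothSectionOn v₂ Set.univ →
    (∀ x, mkC (u₁ x) (v₁ x) ∈ L x) → (∀ x, mkC (u₂ x) (v₂ x) ∈ L x) →
    ∀ x, mkC (dorfman H F u₁ u₂ x - dorfman H F v₁ v₂ x)
      (dorfman H F u₁ v₂ x + dorfman H F v₁ u₂ x) ∈ L x

/-- The `i`-eigenbundle in `E_ℂ` of an endomorphism field of `E`. -/
def iEigenbundle (A : ∀ x : M, Module.End ℝ (Fiber n x)) (x : M) : Submodule ℂ (FiberC n x) :=
  Module.End.eigenspace (LinearMap.baseChange ℂ (A x)) Complex.I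

/-- `A` is (the endomorphism of) a `B_n`-generalized almost complex structure: its
`i`-eigenbundle `L` is such a structure, and `A` vanishes on the vectors which are
orthogonal to `L`, hence to `L ⊕ conj L`. (As `A` is real, `conj L` is then its
`-i`-eigenbundle.) -/
structure IsGenAlmostComplex (A : ∀ x : M, Module.End ℝ (Fiber n x)) : Prop where
  bundle : IsAlmostComplexBundle (iEigenbundle A)
  kernel : ∀ (x : M) (u : Fiber n x),
    (∀ w ∈ iEigenbundle A x, pairingC x ((1 : ℂ) ⊗ₜ[ℝ] u) w = 0) → A x u = 0

/-- `A` is a `B_n`-generalized complex structure on `E_{H,F}`. -/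
structure IsGenComplex (H : FormField n M 3) (F : FormField n M 2)
    (A : ∀ x : M, Module.End ℝ (Fiber n x)) : Prop where
  almost : IsGenAlmostComplex A
  integrable : IsIntegrable H F (iEigenbundle A)

end Complex

/-! ### `B_n`-generalized pseudo-Kähler structures and their components -/

section Kahler

variable {n : ℕ} {M : Type*} [TopologicalSpace M] [ChartedSpace (EuclideanSpace ℝ (Fin n)) M]
  [IsManifold (𝓡 n) ∞ M]

/-- A `B_n`-generalized almost pseudo-Hermitian structure `(𝒢, ℱ)`. -/
structure GenAlmostPseudoHermitian (n : ℕ) (M : Type*) [TopologicalSpace M]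
    [ChartedSpace (EuclideanSpace ℝ (Fin n)) M] [IsManifold (𝓡 n) ∞ M] where
  metric : GeneralizedMetric n M
  endo : ∀ x : M, Module.End ℝ (Fiber n x)
  almostComplex : IsGenAlmostComplex endo
  commute : ∀ x, metric.gEnd x * endo x = endo x * metric.gEnd x

/-- `(𝒢, ℱ)` is a `B_n`-generalized pseudo-Kähler structure on `E_{H,F}`: both `ℱ` and
`𝒢^end ℱ` are `B_n`-generalized complex structures. -/
structure GenAlmostPseudoHermitian.IsPseudoKahler (S : GenAlmostPseudoHermitian n M)
    (H : FormField n M 3) (F : FormField n M 2) : Prop where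
  first : IsGenComplex H F S.endo
  second : IsGenComplex H F (fun x => S.metric.gEnd x * S.endo x)

/-- For odd `n`, the tensor fields `(g, J₊, J₋, X₊, X₋)` are the components of `(𝒢, ℱ)`:
* `𝒢` is in the standard form `E₋ = {X - i_X g}` (hence `E₊ = {X + i_X g + a}`), with `g`
  symmetric;
* under `E₋ ≅ TM`, `ℱ` becomes `J₋`;
* under `E₊ ≅ TM ⊕ ℝ`, `ℱ` becomes `X + a ↦ J₊ X + a X₊ - g(X₊, X)`;
* `X₋ = π(u₋)` for a smooth section `u₋ = X₋ - i_{X₋} g` of `Ker ℱ` with `⟨u₋, u₋⟩ = -1`. -/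
structure GenAlmostPseudoHermitian.HasComponents (S : GenAlmostPseudoHermitian n M)
    (g : ∀ x : M, TangentSpace (𝓡 n) x →L[ℝ] TangentSpace (𝓡 n) x →L[ℝ] ℝ)
    (Jp Jm : ∀ x : M, TangentSpace (𝓡 n) x →L[ℝ] TangentSpace (𝓡 n) x)
    (Xp Xm : ∀ x : M, TangentSpace (𝓡 n) x) : Prop where
  symm : ∀ (x : M) (X Y : TangentSpace (𝓡 n) x), g x X Y = g x Y X
  minus_eq : ∀ (x : M) (u : Fiber n x),
    u ∈ S.metric.minus x ↔ ∃ X : TangentSpace (𝓡 n) x, u = (X, -g x X, 0)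
  endo_minus : ∀ (x : M) (X : TangentSpace (𝓡 n) x),
    S.endo x (X, -g x X, 0) = (Jm x X, -g x (Jm x X), 0)
  endo_plus : ∀ (x : M) (X : TangentSpace (𝓡 n) x) (a : ℝ),
    S.endo x (X, g x X, a) =
      (Jp x X + a • Xp x, g x (Jp x X + a • Xp x), -g x (Xp x) X)
  smooth_um : IsSmoothSectionOn (fun x => ((Xm x, -g x (Xm x), 0) : Fiber n x)) Set.univ
  endo_um : ∀ x : M, S.endo x (Xm x, -g x (Xm x), 0) = 0
  norm_um : ∀ x : M,
    pairing x ((Xm x, -g x (Xm x), 0) : Fiber n x) (Xm x, -g x (Xm x), 0) = -1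

end Kahler

end BnGeom

end

noncomputable section

namespace BnGeom

/-! ### Homogeneity of the differential operators -/

section Forms

variable {n : ℕ} {M : Type*} [TopologicalSpace M] [ChartedSpace (EuclideanSpace ℝ (Fin n)) M]

/-! The structure is transported along the bundle isomorphism `Φ(X + ξ + a) = X + c²ξ + ca`. The
weights 0, 2, 1 make every term of the scalar product homogeneous of degree 2, so `Φ` multiplies it
by `c²` (`pairing_dilation`). They also match the Dorfman bracket term by term once `H` and `F` get
weights 2 and 1, so `Φ` carries the bracket of `E_{H,F}` to that of `E_{c²H,cF}`
(`dorfman_dilation`).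

All the conditions on `(𝒢, ℱ)` are expressed by smooth frames, orthogonality, the anchor (which `Φ`
preserves), conjugation and the bracket. Hence they pass to the image of `E₋` and to the conjugate
of `ℱ` by `Φ`. Reading off the components of the image gives the weights in the statement
(`HasComponents.dilate`).

Uniqueness is pointwise linear algebra: the components fix `E₋` and the values of `ℱ` on both
summands of `E = E₊ ⊕ E₋` (`HasComponents.unique`). -/

theorem FormField.inChart_smul {k : ℕ} (c : ℝ) (α : FormField n M k) (x₀ : M) :
    FormField.inChart (fun x => c • α x) x₀ = c • α.inChart x₀ := by
  ext y v
  rfl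

theorem FormField.d_smul {k : ℕ} (c : ℝ) (α : FormField n M k) (x : M) :
    FormField.d (fun x => c • α x) x = c • α.d x := by
  unfold FormField.d
  rw [FormField.inChart_smul, extDeriv_smul]
  ext v
  rfl

theorem FormField.IsSmooth.smul {k : ℕ} {α : FormField n M k} (hα : α.IsSmooth) (c : ℝ) :
    FormField.IsSmooth (fun x => c • α x) := by
  intro x₀
  rw [FormField.inChart_smul]
  exact (hα x₀).const_smul c

/-- `d` is linear over constants and `F ∧ F` is quadratic in `F`, so both sides of the structure
equation acquire the factor `c²`. -/
theorem IsTwist.scale {H : FormField n M 3} {F : FormField n M 2} (h : IsTwist H F) (c : ℝ) :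
    IsTwist (fun x => c ^ 2 • H x) (fun x => c • F x) where
  smooth_H := h.smooth_H.smul _
  smooth_F := h.smooth_F.smul _
  closed_F := by
    funext x
    rw [FormField.d_smul, h.closed_F]
    exact smul_zero c
  d_H := by
    intro x a b v w
    rw [FormField.d_smul]
    simp only [ContinuousAlternatingMap.smul_apply, h.d_H, smul_eq_mul]
    ring

theorem dFun_smul {c : ℝ} {f : M → ℝ} {x : M} (hf : MDifferentiableAt (𝓡 n) 𝓘(ℝ, ℝ) f x) :
    dFun (n := n) (fun z => c * f z) x = c • dFun f x :=
  const_smul_mfderiv hf c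

theorem contractD_smul (Y : ∀ x : M, TangentSpace (𝓡 n) x) (c : ℝ)
    (ξ : ∀ x : M, TangentSpace (𝓡 n) x →L[ℝ] ℝ) (x : M) :
    contractD Y (fun z => c • ξ z) x = c • contractD Y ξ x := by
  unfold contractD
  have h : (fun z => ContinuousAlternatingMap.ofSubsingleton ℝ (TangentSpace (𝓡 n) z) ℝ
        (0 : Fin 1) (c • ξ z)) =
      fun z => c • ContinuousAlternatingMap.ofSubsingleton ℝ (TangentSpace (𝓡 n) z) ℝ
        (0 : Fin 1) (ξ z) := by
    funext z
    ext v
    simp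
  rw [h, FormField.d_smul]
  ext v
  rfl

/-- Differentiability enters only through the exact term `d(η(X))` of Cartan's formula; the
contraction term is homogeneous without any regularity. -/
theorem lieForm_smul {X : ∀ x : M, TangentSpace (𝓡 n) x} {c : ℝ}
    {η : ∀ x : M, TangentSpace (𝓡 n) x →L[ℝ] ℝ} {x : M}
    (h : MDifferentiableAt (𝓡 n) 𝓘(ℝ, ℝ) (fun z => η z (X z)) x) :
    lieForm X (fun z => c • η z) x = c • lieForm X η x := by
  unfold lieForm
  rw [contractD_smul, smul_add, ← dFun_smul h]
  rfl

end Forms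

/-! ### The dilation `X + ξ + a ↦ X + c² ξ + c a` -/

section Dilation

variable {n : ℕ} {M : Type*} [TopologicalSpace M] [ChartedSpace (EuclideanSpace ℝ (Fin n)) M]

/-- The bundle isomorphism `X + ξ + a ↦ X + c² ξ + c a` of `E`. It multiplies the scalar product
by `c²` and takes the Dorfman bracket of `E_{H,F}` to the one of `E_{c²H,cF}`. -/
def dilation (c : ℝˣ) (x : M) : Fiber n x ≃ₗ[ℝ] Fiber n x where
  toFun u := (u.1, (c : ℝ) ^ 2 • u.2.1, (c : ℝ) * u.2.2)
  invFun u := (u.1, ((c⁻¹ : ℝˣ) : ℝ) ^ 2 • u.2.1, ((c⁻¹ : ℝˣ) : ℝ) * u.2.2)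
  map_add' u v := by simp [mul_add]
  map_smul' r u := by
    ext <;> simp <;> ring
  left_inv u := by
    ext <;> simp
  right_inv u := by
    ext <;> simp

theorem dilation_apply (c : ℝˣ) (x : M) (u : Fiber n x) :
    dilation c x u = (u.1, (c : ℝ) ^ 2 • u.2.1, (c : ℝ) * u.2.2) := rfl

theorem pairing_apply (x : M) (u v : Fiber n x) :
    pairing x u v = (v.2.1 u.1 + u.2.1 v.1) / 2 + u.2.2 * v.2.2 := rfl

theorem pairing_dilation (c : ℝˣ) (x : M) (u v : Fiber n x) :
    pairing x (dilation c x u) (dilation c x v) = (c : ℝ) ^ 2 * pairing x u v := by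
  simp only [pairing_apply, dilation_apply, _root_.smul_apply, smul_eq_mul]
  ring

/-- The complexified dilation. -/
def dilationC (c : ℝˣ) (x : M) : FiberC n x ≃ₗ[ℂ] FiberC n x :=
  (dilation c x).baseChange ℝ ℂ _ _

theorem dilationC_tmul (c : ℝˣ) (x : M) (z : ℂ) (u : Fiber n x) :
    dilationC c x (z ⊗ₜ[ℝ] u) = z ⊗ₜ[ℝ] dilation c x u := rfl

theorem dilationC_mkC (c : ℝˣ) {x : M} (u v : Fiber n x) :
    dilationC c x (mkC u v) = mkC (dilation c x u) (dilation c x v) := by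
  simp only [mkC, map_add, dilationC_tmul]

theorem pairingC_tmul (x : M) (z w : ℂ) (u v : Fiber n x) :
    pairingC x (z ⊗ₜ[ℝ] u) (w ⊗ₜ[ℝ] v) = w * z * pairing x u v := by
  simp [pairingC, LinearMap.BilinForm.baseChange_tmul, mul_comm]

theorem pairingC_dilationC (c : ℝˣ) (x : M) (w z : FiberC n x) :
    pairingC x (dilationC c x w) (dilationC c x z) = (c : ℂ) ^ 2 * pairingC x w z := by
  induction w using TensorProduct.induction_on with
  | zero => simp
  | add w₁ w₂ h₁ h₂ => simp only [map_add, LinearMap.add_apply, h₁, h₂, mul_add]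
  | tmul a u =>
    induction z using TensorProduct.induction_on with
    | zero => simp
    | add z₁ z₂ h₁ h₂ => simp only [map_add, h₁, h₂, mul_add]
    | tmul b v =>
      simp only [dilationC_tmul, pairingC_tmul, pairing_dilation]
      push_cast
      ring

theorem conjC_dilationC (c : ℝˣ) (x : M) (w : FiberC n x) :
    conjC x (dilationC c x w) = dilationC c x (conjC x w) := by
  induction w using TensorProduct.induction_on with
  | zero => simp
  | add w₁ w₂ h₁ h₂ => simp only [map_add, h₁, h₂]
  | tmul a u => rfl

/-- The conjugate of an endomorphism of a fibre of `E` by the dilation. -/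
def dilationConj (c : ℝˣ) (x : M) (A : Module.End ℝ (Fiber n x)) : Module.End ℝ (Fiber n x) :=
  (dilation c x).conj A

theorem dilationConj_dilation (c : ℝˣ) (x : M) (A : Module.End ℝ (Fiber n x)) (u : Fiber n x) :
    dilationConj c x A (dilation c x u) = dilation c x (A u) := by
  simp [dilationConj, LinearEquiv.conj_apply]

theorem dilationConj_mul (c : ℝˣ) (x : M) (A B : Module.End ℝ (Fiber n x)) :
    dilationConj c x (A * B) = dilationConj c x A * dilationConj c x B :=
  map_mul (dilation c x).conjRingEquiv A B

theorem baseChange_dilationConj (c : ℝˣ) (x : M) (A : Module.End ℝ (Fiber n x))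
    (w : FiberC n x) :
    LinearMap.baseChange ℂ (dilationConj c x A) (dilationC c x w) =
      dilationC c x (LinearMap.baseChange ℂ A w) := by
  induction w using TensorProduct.induction_on with
  | zero => simp
  | add w₁ w₂ h₁ h₂ => simp only [map_add, h₁, h₂]
  | tmul a u =>
    rw [dilationC_tmul, LinearMap.baseChange_tmul, LinearMap.baseChange_tmul, dilationC_tmul,
      dilationConj_dilation]

/-- Conjugating an endomorphism moves its eigenspaces by the conjugating isomorphism. Claims about
the conjugated endomorphism thereby become claims about the image of `L`. -/
theorem iEigenbundle_dilationConj (c : ℝˣ) (A : ∀ x : M, Module.End ℝ (Fiber n x)) (x : M) :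
    iEigenbundle (fun x => dilationConj c x (A x)) x =
      (iEigenbundle A x).map (dilationC c x).toLinearMap := by
  ext w
  obtain ⟨w, rfl⟩ := (dilationC c x).surjective w
  rw [iEigenbundle, Module.End.mem_eigenspace_iff, baseChange_dilationConj, ← map_smul,
    (dilationC c x).injective.eq_iff, ← Module.End.mem_eigenspace_iff]
  rw [Submodule.mem_map_equiv, LinearEquiv.symm_apply_apply]
  rfl

end Dilation

/-! ### Smooth sections and the Dorfman bracket under the dilation -/

section Smooth

variable {n : ℕ} {M : Type*} [TopologicalSpace M] [ChartedSpace (EuclideanSpace ℝ (Fin n)) M]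
  [IsManifold (𝓡 n) ∞ M]

/-- Independent weights cover both the dilation, with `(1, c², c)`, and the uniform rescaling by
`c⁻¹` needed to normalize `u₋`. -/
theorem IsSmoothSectionOn.smul_components {u : ∀ x : M, Fiber n x} {s : Set M}
    (hu : IsSmoothSectionOn u s) (p q r : ℝ) :
    IsSmoothSectionOn (fun x => (p • (u x).1, q • (u x).2.1, r * (u x).2.2)) s where
  vector := hu.vector.const_smul_section (a := p)
  form := ContMDiffOn.const_smul_section
    (V := fun x : M => TangentSpace (𝓡 n) x →L[ℝ] Bundle.Trivial M ℝ x) (a := q) hu.form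
  function := contMDiffOn_const.mul hu.function

theorem IsSmoothSectionOn.dilation {u : ∀ x : M, Fiber n x} {s : Set M}
    (hu : IsSmoothSectionOn u s) (c : ℝˣ) :
    IsSmoothSectionOn (fun x => dilation c x (u x)) s := by
  simpa only [one_smul, dilation_apply] using hu.smul_components 1 ((c : ℝ) ^ 2) c

theorem IsSmoothSectionOn.mdifferentiableAt_function {u : ∀ x : M, Fiber n x}
    (hu : IsSmoothSectionOn u Set.univ) (x : M) :
    MDifferentiableAt (𝓡 n) 𝓘(ℝ, ℝ) (fun z => (u z).2.2) x :=
  (contMDiffOn_univ.mp hu.function).mdifferentiable (by simp) x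

theorem IsSmoothSectionOn.mdifferentiableAt_contraction {u v : ∀ x : M, Fiber n x}
    (hu : IsSmoothSectionOn u Set.univ) (hv : IsSmoothSectionOn v Set.univ) (x : M) :
    MDifferentiableAt (𝓡 n) 𝓘(ℝ, ℝ) (fun z => (v z).2.1 (u z).1) x := by
  have h₁ := (contMDiffOn_univ.mp hv.form).mdifferentiable (by simp) x
  have h₂ := (contMDiffOn_univ.mp hu.vector).mdifferentiable (by simp) x
  have h := h₁.clm_bundle_apply (F₁ := EuclideanSpace ℝ (Fin n)) (F₂ := ℝ)
    (E₁ := fun x : M => TangentSpace (𝓡 n) x) (E₂ := Bundle.Trivial M ℝ) h₂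
  rw [mdifferentiableAt_section] at h
  exact h

/-- A count of weights: in the one-form part, `ℒ_X η`, `i_Y dξ`, `b da`, `i_X i_Y H`, `b i_X F` and
`a i_Y F` all have weight 2; in the function part, `X(b)`, `Y(a)` and `F(X, Y)` have weight 1; the
Lie bracket has weight 0. -/
theorem dorfman_dilation (c : ℝˣ) (H : FormField n M 3) (F : FormField n M 2)
    {u v : ∀ x : M, Fiber n x} (hu : IsSmoothSectionOn u Set.univ)
    (hv : IsSmoothSectionOn v Set.univ) (x : M) :
    dorfman (fun x => (c : ℝ) ^ 2 • H x) (fun x => (c : ℝ) • F x)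
        (fun x => dilation c x (u x)) (fun x => dilation c x (v x)) x =
      dilation c x (dorfman H F u v x) := by
  simp only [dorfman, dilation_apply]
  refine Prod.ext rfl (Prod.ext ?_ ?_)
  · dsimp only
    rw [lieForm_smul (hu.mdifferentiableAt_contraction hv x), contractD_smul,
      dFun_smul (hu.mdifferentiableAt_function x)]
    ext w
    simp
    ring
  · dsimp only
    rw [dFun_smul (hu.mdifferentiableAt_function x), dFun_smul (hv.mdifferentiableAt_function x)]
    simp
    ring

end Smooth

section Transport

variable {n : ℕ} {M : Type*} [TopologicalSpace M] [ChartedSpace (EuclideanSpace ℝ (Fin n)) M]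
  [IsManifold (𝓡 n) ∞ M]

/-! ### Transport of generalized metrics -/

theorem GeneralizedMetric.gEnd_of_mem_plus (G : GeneralizedMetric n M) {x : M} {u : Fiber n x}
    (hu : u ∈ G.plus x) : G.gEnd x u = u := by
  rw [gEnd, LinearMap.sub_apply, Submodule.projection_apply_of_mem_left _ hu,
    (Submodule.projection_apply_eq_zero_iff _).mpr hu, sub_zero]

theorem GeneralizedMetric.gEnd_of_mem_minus (G : GeneralizedMetric n M) {x : M} {u : Fiber n x}
    (hu : u ∈ G.minus x) : G.gEnd x u = -u := by
  rw [gEnd, LinearMap.sub_apply, Submodule.projection_apply_of_mem_left _ hu,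
    (Submodule.projection_apply_eq_zero_iff _).mpr hu, zero_sub]

/-- The image of a generalized metric under the dilation. -/
def GeneralizedMetric.dilate (c : ℝˣ) (G : GeneralizedMetric n M) : GeneralizedMetric n M where
  minus x := (G.minus x).map (dilation c x).toLinearMap
  smooth x₀ := by
    obtain ⟨U, hU, hx₀, s, hs, hspan⟩ := G.smooth x₀
    refine ⟨U, hU, hx₀, fun i x => dilation c x (s i x), fun i => (hs i).dilation c,
      fun x hx => ⟨?_, ?_⟩⟩
    · exact (hspan x hx).1.map' (dilation c x).toLinearMap (dilation c x).ker
    · rw [← (hspan x hx).2, Submodule.map_span, ← Set.range_comp]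
      rfl
  nondegenerate x := by
    have hc : (c : ℝ) ^ 2 ≠ 0 := pow_ne_zero 2 c.ne_zero
    obtain ⟨h₁, h₂⟩ := G.nondegenerate x
    refine ⟨?_, ?_⟩
    · rintro ⟨_, u, hu, rfl⟩ h
      have : (⟨u, hu⟩ : G.minus x) = 0 := h₁ _ fun v => by
        have := h ⟨dilation c x v, Submodule.mem_map_of_mem v.2⟩
        have h' : pairing x (dilation c x u) (dilation c x v) = 0 := this
        rw [pairing_dilation] at h'
        exact (mul_eq_zero.mp h').resolve_left hc
      rw [Submodule.mk_eq_zero] at this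
      simp [this]
    · rintro ⟨_, u, hu, rfl⟩ h
      have : (⟨u, hu⟩ : G.minus x) = 0 := h₂ _ fun v => by
        have := h ⟨dilation c x v, Submodule.mem_map_of_mem v.2⟩
        have h' : pairing x (dilation c x v) (dilation c x u) = 0 := this
        rw [pairing_dilation] at h'
        exact (mul_eq_zero.mp h').resolve_left hc
      rw [Submodule.mk_eq_zero] at this
      simp [this]
  admissible x := by
    obtain ⟨h₁, h₂⟩ := G.admissible x
    refine ⟨?_, fun X => ?_⟩
    · rintro ⟨_, u, hu, rfl⟩ ⟨_, v, hv, rfl⟩ h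
      have : (⟨u, hu⟩ : G.minus x) = ⟨v, hv⟩ := h₁ h
      have huv : u = v := congrArg Subtype.val this
      subst huv
      rfl
    · obtain ⟨u, hu⟩ := h₂ X
      exact ⟨⟨dilation c x u, Submodule.mem_map_of_mem u.2⟩, hu⟩

/-- A conformal isomorphism preserves orthogonality, so `E₊` as well as `E₋` goes into its
counterpart. The two endomorphisms are then compared on each summand. -/
theorem GeneralizedMetric.gEnd_dilate (c : ℝˣ) (G : GeneralizedMetric n M) (x : M) :
    (G.dilate c).gEnd x = dilationConj c x (G.gEnd x) := by
  have hmem : ∀ u, u ∈ G.plus x → dilation c x u ∈ (G.dilate c).plus x := by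
    intro u hu
    rw [plus, LinearMap.BilinForm.mem_orthogonal_iff] at hu ⊢
    rintro _ ⟨v, hv, rfl⟩
    have h : pairing x v u = 0 := hu v hv
    change pairing x (dilation c x v) (dilation c x u) = 0
    rw [pairing_dilation, h, mul_zero]
  refine LinearMap.ext fun w => ?_
  obtain ⟨u, rfl⟩ := (dilation c x).surjective w
  rw [dilationConj_dilation]
  obtain ⟨p, hp, m, hm, rfl⟩ := Submodule.mem_sup.mp
    ((G.isCompl x).sup_eq_top ▸ Submodule.mem_top : u ∈ G.plus x ⊔ G.minus x)
  have hm' : dilation c x m ∈ (G.dilate c).minus x := Submodule.mem_map_of_mem hm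
  simp only [map_add, gEnd_of_mem_plus _ hp, gEnd_of_mem_minus _ hm,
    gEnd_of_mem_plus _ (hmem p hp), gEnd_of_mem_minus _ hm', map_neg]

/-! ### Transport of `B_n`-generalized complex structures -/

theorem IsAlmostComplexBundle.dilate (c : ℝˣ) {L : ∀ x : M, Submodule ℂ (FiberC n x)}
    (h : IsAlmostComplexBundle L) :
    IsAlmostComplexBundle (fun x => (L x).map (dilationC c x).toLinearMap) where
  subbundle x₀ := by
    obtain ⟨U, hU, hx₀, s, t, hst, hspan⟩ := h.subbundle x₀
    refine ⟨U, hU, hx₀, fun i x => dilation c x (s i x), fun i x => dilation c x (t i x),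
      fun i => ⟨(hst i).1.dilation c, (hst i).2.dilation c⟩, fun x hx => ?_⟩
    simp only [← dilationC_mkC]
    refine ⟨(hspan x hx).1.map' (dilationC c x).toLinearMap (dilationC c x).ker, ?_⟩
    rw [← (hspan x hx).2, Submodule.map_span, ← Set.range_comp]
    rfl
  isotropic x := by
    rintro _ ⟨w, hw, rfl⟩ _ ⟨z, hz, rfl⟩
    have := h.isotropic x w hw z hz
    change pairingC x (dilationC c x w) (dilationC c x z) = 0
    rw [pairingC_dilationC, this, mul_zero]
  transversal x := by
    rintro _ ⟨w, hw, rfl⟩ hconj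
    have hconj' : conjC x w ∈ L x := by
      change conjC x (dilationC c x w) ∈ _ at hconj
      rwa [conjC_dilationC, Submodule.mem_map_equiv, LinearEquiv.symm_apply_apply] at hconj
    rw [h.transversal x w hw hconj', map_zero]

theorem IsGenAlmostComplex.dilate (c : ℝˣ) {A : ∀ x : M, Module.End ℝ (Fiber n x)}
    (h : IsGenAlmostComplex A) : IsGenAlmostComplex (fun x => dilationConj c x (A x)) where
  bundle := by
    rw [funext (iEigenbundle_dilationConj c A)]
    exact h.bundle.dilate c
  kernel x u hu := by
    obtain ⟨u, rfl⟩ := (dilation c x).surjective u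
    rw [dilationConj_dilation, h.kernel x u, map_zero]
    intro w hw
    have h' := hu (dilationC c x w)
      (by rw [iEigenbundle_dilationConj]; exact Submodule.mem_map_of_mem hw)
    rw [← dilationC_tmul, pairingC_dilationC] at h'
    exact (mul_eq_zero.mp h').resolve_left
      (pow_ne_zero 2 (Complex.ofReal_ne_zero.mpr c.ne_zero))

theorem IsIntegrable.dilate (c : ℝˣ) {H : FormField n M 3} {F : FormField n M 2}
    {L : ∀ x : M, Submodule ℂ (FiberC n x)} (h : IsIntegrable H F L) :
    IsIntegrable (fun x => (c : ℝ) ^ 2 • H x) (fun x => (c : ℝ) • F x)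
      (fun x => (L x).map (dilationC c x).toLinearMap) := by
  intro u₁ v₁ u₂ v₂ hu₁ hv₁ hu₂ hv₂ h₁ h₂ x
  -- The inverse of the dilation is the dilation by `c⁻¹`, so it preserves smoothness and arbitrary
  -- smooth sections can be pulled back to `E_{H,F}`.
  have key : ∀ u : ∀ x : M, Fiber n x, IsSmoothSectionOn u Set.univ →
      ∃ u' : ∀ x : M, Fiber n x, IsSmoothSectionOn u' Set.univ ∧
        u = fun x => dilation c x (u' x) := fun u hu =>
    ⟨fun x => dilation c⁻¹ x (u x), hu.dilation c⁻¹, by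
      funext x
      exact ((dilation c x).apply_symm_apply (u x)).symm⟩
  obtain ⟨u₁, hu₁', rfl⟩ := key u₁ hu₁
  obtain ⟨v₁, hv₁', rfl⟩ := key v₁ hv₁
  obtain ⟨u₂, hu₂', rfl⟩ := key u₂ hu₂
  obtain ⟨v₂, hv₂', rfl⟩ := key v₂ hv₂
  simp only [← dilationC_mkC, Submodule.mem_map_equiv, LinearEquiv.symm_apply_apply] at h₁ h₂
  rw [dorfman_dilation c H F hu₁' hu₂', dorfman_dilation c H F hv₁' hv₂',
    dorfman_dilation c H F hu₁' hv₂', dorfman_dilation c H F hv₁' hu₂', ← map_sub, ← map_add,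
    ← dilationC_mkC]
  exact Submodule.mem_map_of_mem (h u₁ v₁ u₂ v₂ hu₁' hv₁' hu₂' hv₂' h₁ h₂ x)

theorem IsGenComplex.dilate (c : ℝˣ) {H : FormField n M 3} {F : FormField n M 2}
    {A : ∀ x : M, Module.End ℝ (Fiber n x)} (h : IsGenComplex H F A) :
    IsGenComplex (fun x => (c : ℝ) ^ 2 • H x) (fun x => (c : ℝ) • F x)
      (fun x => dilationConj c x (A x)) where
  almost := h.almost.dilate c
  integrable := by
    rw [funext (iEigenbundle_dilationConj c A)]
    exact h.integrable.dilate c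

/-! ### Transport of `B_n`-generalized pseudo-Kähler structures -/

/-- The image of a `B_n`-generalized almost pseudo-Hermitian structure under the dilation. -/
def GenAlmostPseudoHermitian.dilate (c : ℝˣ) (S : GenAlmostPseudoHermitian n M) :
    GenAlmostPseudoHermitian n M where
  metric := S.metric.dilate c
  endo x := dilationConj c x (S.endo x)
  almostComplex := S.almostComplex.dilate c
  commute x := by
    rw [GeneralizedMetric.gEnd_dilate, ← dilationConj_mul, S.commute, dilationConj_mul]

theorem GenAlmostPseudoHermitian.IsPseudoKahler.dilate (c : ℝˣ)
    {S : GenAlmostPseudoHermitian n M} {H : FormField n M 3} {F : FormField n M 2}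
    (h : S.IsPseudoKahler H F) :
    (S.dilate c).IsPseudoKahler (fun x => (c : ℝ) ^ 2 • H x) (fun x => (c : ℝ) • F x) where
  first := h.first.dilate c
  second := by
    have he : (fun x => (S.dilate c).metric.gEnd x * (S.dilate c).endo x) =
        fun x => dilationConj c x (S.metric.gEnd x * S.endo x) := by
      funext x
      rw [dilationConj_mul, ← GeneralizedMetric.gEnd_dilate]
      rfl
    rw [he]
    exact h.second.dilate c

/-- The one-form weight turns `g` into `c²g`, while `J_±` act on the unscaled vector part. Since the
function part scales by `c`, `X₊` must scale by `c⁻¹`; since norms scale by `c²`, so must `X₋`. -/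
theorem GenAlmostPseudoHermitian.HasComponents.dilate (c : ℝˣ)
    {S : GenAlmostPseudoHermitian n M}
    {g : ∀ x : M, TangentSpace (𝓡 n) x →L[ℝ] TangentSpace (𝓡 n) x →L[ℝ] ℝ}
    {Jp Jm : ∀ x : M, TangentSpace (𝓡 n) x →L[ℝ] TangentSpace (𝓡 n) x}
    {Xp Xm : ∀ x : M, TangentSpace (𝓡 n) x} (h : S.HasComponents g Jp Jm Xp Xm) :
    (S.dilate c).HasComponents (fun x => (c : ℝ) ^ 2 • g x) Jp Jm
      (fun x => (c : ℝ)⁻¹ • Xp x) (fun x => (c : ℝ)⁻¹ • Xm x) := by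
  have hc : (c : ℝ) ≠ 0 := c.ne_zero
  have hminus : ∀ (x : M) (X : TangentSpace (𝓡 n) x),
      ((X, -((c : ℝ) ^ 2 • g x) X, 0) : Fiber n x) = dilation c x (X, -g x X, 0) := by
    intro x X
    simp [dilation_apply]
  have hXm : ∀ x : M, ((((c : ℝ)⁻¹ • Xm x, -((c : ℝ) ^ 2 • g x) ((c : ℝ)⁻¹ • Xm x), 0)) :
      Fiber n x) = (c : ℝ)⁻¹ • dilation c x (Xm x, -g x (Xm x), 0) := by
    intro x
    rw [hminus, ← map_smul]
    simp
  refine ⟨?_, ?_, ?_, ?_, ?_, ?_, ?_⟩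
  · intro x X Y
    simp [h.symm x X Y]
  · intro x u
    simp only [hminus]
    constructor
    · rintro ⟨v, hv, rfl⟩
      obtain ⟨X, rfl⟩ := (h.minus_eq x v).mp hv
      exact ⟨X, rfl⟩
    · rintro ⟨X, rfl⟩
      exact Submodule.mem_map_of_mem ((h.minus_eq x _).mpr ⟨X, rfl⟩)
  · intro x X
    rw [hminus, hminus, ← h.endo_minus]
    exact dilationConj_dilation c x (S.endo x) _
  · intro x X a
    -- The preimage has function part `c⁻¹a`, whence `c⁻¹X₊`. The function part agrees because `c
    -- g(X₊, X) = (c²g)(c⁻¹X₊, X)`.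
    have h₁ : ((X, ((c : ℝ) ^ 2 • g x) X, a) : Fiber n x) =
        dilation c x (X, g x X, (c : ℝ)⁻¹ * a) := by
      simp [dilation_apply, hc]
    have h₂ := dilationConj_dilation c x (S.endo x) (X, g x X, (c : ℝ)⁻¹ * a)
    rw [h.endo_plus] at h₂
    rw [h₁]
    refine h₂.trans ?_
    refine Prod.ext ?_ (Prod.ext ?_ ?_)
    · simp [dilation_apply, smul_smul, mul_comm]
    · simp [dilation_apply, smul_smul, mul_comm]
    · simp [dilation_apply]
      field_simp
  · have := (h.smooth_um.dilation c).smul_components (c : ℝ)⁻¹ (c : ℝ)⁻¹ (c : ℝ)⁻¹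
    simp only [hXm]
    exact this
  · intro x
    have h₂ := dilationConj_dilation c x (S.endo x) (Xm x, -g x (Xm x), 0)
    rw [h.endo_um, map_zero] at h₂
    rw [hXm, map_smul]
    exact (congrArg _ h₂).trans (smul_zero _)
  · intro x
    -- The two factors `c⁻¹` cancel the conformal factor `c²`, leaving the norm `-1`.
    rw [hXm, map_smul, LinearMap.map_smul, LinearMap.smul_apply, pairing_dilation, h.norm_um]
    simp only [smul_eq_mul]
    field_simp

/-! ### Uniqueness -/

theorem GenAlmostPseudoHermitian.ext {S T : GenAlmostPseudoHermitian n M}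
    (h₁ : S.metric.minus = T.metric.minus) (h₂ : S.endo = T.endo) : S = T := by
  obtain ⟨⟨m, _, _, _⟩, e, _, _⟩ := S
  obtain ⟨⟨m', _, _, _⟩, e', _, _⟩ := T
  subst h₁ h₂
  rfl

/-- In the presence of components, `E = E₊ ⊕ E₋` reads
`E = {X + i_X g + a} ⊕ {Y - i_Y g}`. -/
theorem GenAlmostPseudoHermitian.HasComponents.exists_decomposition
    {S : GenAlmostPseudoHermitian n M}
    {g : ∀ x : M, TangentSpace (𝓡 n) x →L[ℝ] TangentSpace (𝓡 n) x →L[ℝ] ℝ}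
    {Jp Jm : ∀ x : M, TangentSpace (𝓡 n) x →L[ℝ] TangentSpace (𝓡 n) x}
    {Xp Xm : ∀ x : M, TangentSpace (𝓡 n) x} (h : S.HasComponents g Jp Jm Xp Xm) (x : M)
    (u : Fiber n x) : ∃ (X Y : TangentSpace (𝓡 n) x) (a : ℝ),
      u = ((X, g x X, a) : Fiber n x) + ((Y, -g x Y, 0) : Fiber n x) := by
  obtain ⟨p, hp, m, hm, rfl⟩ := Submodule.mem_sup.mp
    ((S.metric.isCompl x).sup_eq_top ▸ Submodule.mem_top :
      u ∈ S.metric.plus x ⊔ S.metric.minus x)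
  obtain ⟨Y, rfl⟩ := (h.minus_eq x m).mp hm
  refine ⟨p.1, Y, p.2.2, ?_⟩
  congr 1
  -- Only the one-form part of `p ∈ E₊` is constrained: pairing `p` with `Z - i_Z g` for every `Z`
  -- forces it to be `i_X g`, where `X` is the vector part.
  refine Prod.ext rfl (Prod.ext ?_ rfl)
  ext Z
  rw [GeneralizedMetric.plus, LinearMap.BilinForm.mem_orthogonal_iff] at hp
  have hZ : pairing x (Z, -g x Z, 0) p = 0 := hp _ ((h.minus_eq x _).mpr ⟨Z, rfl⟩)
  simp only [pairing_apply, _root_.neg_apply, zero_mul, add_zero] at hZ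
  change p.2.1 Z = g x p.1 Z
  rw [h.symm x p.1 Z]
  linarith

/-- `g` determines `E₋`, and the component formulas give `ℱ` on `{X + i_X g + a}` and `{Y - i_Y g}`,
which together span `E`. -/
theorem GenAlmostPseudoHermitian.HasComponents.unique {S T : GenAlmostPseudoHermitian n M}
    {g : ∀ x : M, TangentSpace (𝓡 n) x →L[ℝ] TangentSpace (𝓡 n) x →L[ℝ] ℝ}
    {Jp Jm : ∀ x : M, TangentSpace (𝓡 n) x →L[ℝ] TangentSpace (𝓡 n) x}
    {Xp Xm : ∀ x : M, TangentSpace (𝓡 n) x} (hS : S.HasComponents g Jp Jm Xp Xm)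
    (hT : T.HasComponents g Jp Jm Xp Xm) : S = T := by
  refine GenAlmostPseudoHermitian.ext ?_ ?_
  · funext x
    ext u
    rw [hS.minus_eq, hT.minus_eq]
  · funext x
    refine LinearMap.ext fun u => ?_
    obtain ⟨X, Y, a, rfl⟩ := hS.exists_decomposition x u
    rw [map_add, map_add, hS.endo_plus, hT.endo_plus, hS.endo_minus, hT.endo_minus]

end Transport
end BnGeom

end
theorem mainTheorem6 {n : ℕ} (hn : Odd n)
    {M : Type*} [TopologicalSpace M] [ChartedSpace (EuclideanSpace ℝ (Fin n)) M]
    [IsManifold (𝓡 n) ∞ M] [T2Space M] [SigmaCompactSpace M]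
    (H : BnGeom.FormField n M 3) (F : BnGeom.FormField n M 2) (hHF : BnGeom.IsTwist H F)
    (S : BnGeom.GenAlmostPseudoHermitian n M) (hS : S.IsPseudoKahler H F)
    (g : ∀ x : M, TangentSpace (𝓡 n) x →L[ℝ] TangentSpace (𝓡 n) x →L[ℝ] ℝ)
    (Jp Jm : ∀ x : M, TangentSpace (𝓡 n) x →L[ℝ] TangentSpace (𝓡 n) x)
    (Xp Xm : ∀ x : M, TangentSpace (𝓡 n) x)
    (hcomp : S.HasComponents g Jp Jm Xp Xm)
    (c : ℝ) (hc : c ≠ 0) :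
    BnGeom.IsTwist (fun x => c ^ 2 • H x) (fun x => c • F x) ∧
    ∃! S' : BnGeom.GenAlmostPseudoHermitian n M,
      S'.IsPseudoKahler (fun x => c ^ 2 • H x) (fun x => c • F x) ∧
      S'.HasComponents (fun x => c ^ 2 • g x) Jp Jm (fun x => c⁻¹ • Xp x) (fun x => c⁻¹ • Xm x) := by
  exact ⟨hHF.scale c, S.dilate (Units.mk0 c hc), ⟨hS.dilate _, hcomp.dilate _⟩,
      fun _ hT => hT.2.unique (hcomp.dilate (Units.mk0 c hc))⟩
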